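/- Let $n,m$ be positive integers, let $q\neq 0$ and $h,t$ be complex numbers, fix a value $L$ of $\log q$, and put $q^s:=e^{sL}$ for $s\in\mathbb C$. Assume $$0<|q^h|<1,\qquad 0<|q^t|<1,\qquad 0<|q^{ht}|<1 .$$ For complex $A,p$ with $|p|<1$ put $(A;p)_\infty=\prod_{i\ge 0}(1-Ap^i)$ and, for a non-negative integer $k$, $(A;p)_k=\prod_{i=0}^{k-1}(1-Ap^i)$. For a complex index $s$ and a base $q^c$ with $|q^c|<1$, put $(A;q^c)_s=(A;q^c)_\infty/(Aq^{cs};q^c)_\infty$, and $1/(A;q^c)_s=(Aq^{cs};q^c)_\infty/(A;q^c)_\infty$ in denominators. For $\mathbf k=(k_1,\dots,k_n)\in\mathbb Z_{\ge0}^n$ put $|\mathbf k|=k_1+\cdots+k_n$; for $\mathbf j=(j_1,\dots,j_m)\in\mathbb Z_{\ge0}^m$ put $|\mathbf j|=j_1+\cdots+j_m$ and $e_2(\mathbf j)=\sum_{1\le r<s\le m}j_rj_s$. Let $a_1,\dots,a_n$, $b_1,\dots,b_m$, $z$, $w$ be complex numbers, and let $x_1,\dots,x_n$, $y_1,\dots,y_m$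 be non-zero complex numbers, with $|z|<1$ and $|w/y_r|<1$ for $r=1,\dots,m$. Suppose that no denominator below vanishes, that is, for all integers $i\ge0$: $x_rq^{hi}\ne x_s$ and $y_rq^{ti}\neq y_s$ whenever $r\ne s$; $a_1\cdots a_n z\,q^{hi}\ne1$; and $b_rwq^{ti}/y_r\neq1$ for $r=1,\dots,m$. Then $$ \begin{aligned} \sum_{k_1,\dots,k_n\ge0}&\ \prod_{1\le r<s\le n}\frac{1-q^{h(k_r-k_s)}x_r/x_s}{1-x_r/x_s}\ \prod_{r,s=1}^n\frac{(a_sx_r/x_s;q^h)_{k_r}}{(q^hx_r/x_s;q^h)_{k_r}}\ \prod_{r=1}^m\frac{(w/y_r;q^t)_{h|\mathbf k|}}{(b_rw/y_r;q^t)_{h|\mathbf k|}}\; z^{|\mathbf k|}\,q^{h\sum_{r=1}^n(r-1)k_r}\\ &=\prod_{r=1}^m\frac{(w/y_r;q^t)_\infty}{(b_rw/y_r;q^t)_\infty}\cdot\frac{(a_1\cdots a_nz;q^h)_\infty}{(z;q^h)_\infty}\\ &\quad\times\sum_{j_1,\dots,j_m\ge0}\ \prod_{1\le r<s\le m}\frac{1-q^{t(j_r-j_s)}y_r/y_s}{1-y_r/y_s}\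 \prod_{r,s=1}^m\frac{(b_sy_r/y_s;q^t)_{j_r}}{(q^ty_r/y_s;q^t)_{j_r}}\ \frac{(z;q^h)_{t|\mathbf j|}}{(a_1\cdots a_nz;q^h)_{t|\mathbf j|}}\\ &\qquad\qquad\times w^{|\mathbf j|}\,q^{t\sum_{r=1}^m(r-1)j_r}\,q^{t\,e_2(\mathbf j)}\prod_{r=1}^m y_r^{-j_r}, \end{aligned} $$ and both multiple series converge absolutely. -/

import Mathlib

namespace BibasicHeine

/-- The power `q ^ s` of `q = exp L` to a complex exponent `s`, taken with respect to the
fixed value `L` of `log q`. -/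
noncomputable def qPow (L s : ℂ) : ℂ := Complex.exp (s * L)

/-- For the principal value of the logarithm this is the usual complex power. -/
theorem qPow_log {q : ℂ} (hq : q ≠ 0) (s : ℂ) : qPow (Complex.log q) s = q ^ s := by
  rw [qPow, Complex.cpow_def_of_ne_zero hq, mul_comm]

/-- The finite rising factorial `(A; p)_k = (1 - A)(1 - A p) ⋯ (1 - A p ^ (k - 1))`. -/
noncomputable def rfac (A p : ℂ) (k : ℕ) : ℂ := ∏ i ∈ Finset.range k, (1 - A * p ^ i)

/-- The infinite rising factorial `(A; p)_∞ = ∏_{i ≥ 0} (1 - A p ^ i)`, for `|p| < 1`. -/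
noncomputable def rfacInf (A p : ℂ) : ℂ := ∏' i : ℕ, (1 - A * p ^ i)

/-- The rising factorial `(A; q ^ c)_s` with a complex index `s`, which is
`(A; q ^ c)_∞ / (A q ^ (c s); q ^ c)_∞`.

It is used below with `s = d * k`, `k` a natural number, in quotients `(A; q ^ c)_s / (B; q ^ c)_s`
with `(B; q ^ c)_∞ ≠ 0`. If `(B q ^ (c s); q ^ c)_∞ = 0` then `1 / (B; q ^ c)_s`, which is
`(B q ^ (c s); q ^ c)_∞ / (B; q ^ c)_∞`, is zero, and so it is with Lean's division by zero. -/
noncomputable def rfacC (L c A s : ℂ) : ℂ :=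
  rfacInf A (qPow L c) / rfacInf (A * qPow L (c * s)) (qPow L c)

/-- `|k| = k_1 + ⋯ + k_n`. -/
def size {n : ℕ} (k : Fin n → ℕ) : ℕ := ∑ r, k r

/-- The elementary symmetric function `e_2(k) = ∑_{r < s} k_r k_s`. -/
def e2 {n : ℕ} (k : Fin n → ℕ) : ℕ := ∑ r, ∑ s ∈ Finset.Ioi r, k r * k s

/-- The Vandermonde factor of type `A` in base `q ^ h`:
`∏_{r < s} (1 - q ^ (h (k_r - k_s)) x_r / x_s) / (1 - x_r / x_s)`. -/
noncomputable def vandermonde (L h : ℂ) {n : ℕ} (x : Fin n → ℂ) (k : Fin n → ℕ) : ℂ :=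
  ∏ r, ∏ s ∈ Finset.Ioi r,
    (1 - qPow L (h * ((k r : ℂ) - (k s : ℂ))) * (x r / x s)) / (1 - x r / x s)

/-- `∏_{r,s} (a_s x_r / x_s; q ^ h)_{k_r} / (q ^ h x_r / x_s; q ^ h)_{k_r}`. -/
noncomputable def sqProd (L h : ℂ) {n : ℕ} (a x : Fin n → ℂ) (k : Fin n → ℕ) : ℂ :=
  ∏ r, ∏ s, rfac (a s * x r / x s) (qPow L h) (k r) /
    rfac (qPow L h * (x r / x s)) (qPow L h) (k r)

/-- The summand of the `n`-fold series. The index `r : Fin n` counts from `0`, so it stands for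
`r - 1` in the usual numbering `1, …, n`. -/
noncomputable def leftTerm (L h t : ℂ) {n m : ℕ} (a x : Fin n → ℂ) (b y : Fin m → ℂ) (z w : ℂ)
    (k : Fin n → ℕ) : ℂ :=
  vandermonde L h x k * sqProd L h a x k *
    (∏ r, rfacC L t (w / y r) (h * (size k : ℂ)) / rfacC L t (b r * w / y r) (h * (size k : ℂ))) *
    z ^ size k * qPow L (h * ∑ r : Fin n, ((r : ℕ) : ℂ) * (k r : ℂ))

/-- The summand of the `m`-fold series. -/
noncomputable def rightTerm (L h t : ℂ) {n m : ℕ} (a : Fin n → ℂ) (b y : Fin m → ℂ) (z w : ℂ)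
    (j : Fin m → ℕ) : ℂ :=
  vandermonde L t y j * sqProd L t b y j *
    (rfacC L h z (t * (size j : ℂ)) / rfacC L h ((∏ r, a r) * z) (t * (size j : ℂ))) *
    w ^ size j * qPow L (t * ∑ r : Fin m, ((r : ℕ) : ℂ) * (j r : ℂ)) *
    qPow L (t * (e2 j : ℂ)) * ∏ r, (y r ^ j r)⁻¹

end BibasicHeine

namespace BibasicHeine

open Finset Filter Topology

section Interpolation

open Polynomial

/-- Lagrange interpolation of the difference of two monic polynomials given by their roots. -/
theorem prod_sub_eq_prod_sub_add_sum {ι : Type*} [Fintype ι] [DecidableEq ι] {u : ι → ℂ}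
    (hu : Function.Injective u) (v : ι → ℂ) (x : ℂ) :
    ∏ s, (x - v s) = ∏ s, (x - u s) +
      ∑ r, (∏ s, (u r - v s)) * ∏ s ∈ univ.erase r, (x - u s) / (u r - u s) := by
  have hdeg : (Lagrange.nodal univ v - Lagrange.nodal univ u).degree < #(univ : Finset ι) := by
    rw [← Lagrange.degree_nodal (v := v)]
    refine degree_sub_lt_left ?_ Lagrange.nodal_ne_zero ?_
    · rw [Lagrange.degree_nodal, Lagrange.degree_nodal]
    · rw [Lagrange.nodal_monic.leadingCoeff, Lagrange.nodal_monic.leadingCoeff]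
  have h := congrArg (Polynomial.eval x) (Lagrange.eq_interpolate (s := univ) hu.injOn hdeg)
  rw [Lagrange.interpolate_apply, eval_finsetSum, eval_sub, Lagrange.eval_nodal,
    Lagrange.eval_nodal] at h
  rw [← sub_eq_iff_eq_add', h]
  refine sum_congr rfl fun r _ => ?_
  rw [eval_mul, eval_C, eval_sub, Lagrange.eval_nodal, Lagrange.eval_nodal_at_node (mem_univ r),
    sub_zero, Lagrange.basis, eval_prod]
  congr 1
  refine prod_congr rfl fun s _ => ?_
  rw [Lagrange.basisDivisor, eval_mul, eval_C, eval_sub, eval_X, eval_C]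
  ring

/-- The homogeneous form of `prod_sub_eq_prod_sub_add_sum`. -/
theorem prod_one_sub_mul_eq {ι : Type*} [Fintype ι] [DecidableEq ι] {u : ι → ℂ}
    (hu : Function.Injective u) (v : ι → ℂ) (c : ℂ) :
    ∏ s, (1 - c * v s) = ∏ s, (1 - c * u s) +
      ∑ r, c * (∏ s, (u r - v s)) * ∏ s ∈ univ.erase r, (1 - c * u s) / (u r - u s) := by
  rcases eq_or_ne c 0 with rfl | hc
  · simp
  have key (y : ℂ) : 1 - c * y = c * (c⁻¹ - y) := by field_simp
  simp only [key, mul_div_assoc, prod_mul_distrib, prod_const, card_erase_of_mem (mem_univ _)]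
  rw [prod_sub_eq_prod_sub_add_sum hu v, mul_add, mul_sum]
  congr 1
  refine sum_congr rfl fun r _ => ?_
  obtain ⟨k, hk⟩ : ∃ k, #(univ : Finset ι) = k + 1 :=
    Nat.exists_eq_succ_of_ne_zero (card_pos.2 ⟨r, mem_univ r⟩).ne'
  rw [hk, Nat.add_sub_cancel]
  ring

theorem sum_prod_div_prod_eq_one_sub_prod {ι : Type*} [Fintype ι] [DecidableEq ι] {X : ι → ℂ}
    (hX : Function.Injective X) (hX0 : ∀ r, X r ≠ 0) (β : ι → ℂ) :
    ∑ r, (∏ s, (1 - β s * X r / X s)) / ∏ s ∈ univ.erase r, (1 - X r / X s) = 1 - ∏ s, β s := by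
  have hinj : Function.Injective fun s => (X s)⁻¹ := fun i j h => hX (inv_injective h)
  have h := prod_sub_eq_prod_sub_add_sum hinj (fun s => β s * (X s)⁻¹) 0
  have h' := congrArg ((∏ s, (-X s)) * ·) h
  simp only [mul_add, mul_sum, ← prod_mul_distrib] at h'
  have e1 : ∏ s, (-X s * (0 - β s * (X s)⁻¹)) = ∏ s, β s :=
    prod_congr rfl fun s _ => by have := hX0 s; field_simp; ring
  have e2 : ∏ s, (-X s * (0 - (X s)⁻¹)) = 1 :=
    prod_eq_one fun s _ => by have := hX0 s; field_simp; ring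
  rw [e1, e2] at h'
  rw [h', sub_add_cancel_left, ← sum_neg_distrib]
  refine sum_congr rfl fun r _ => ?_
  rw [← mul_prod_erase univ (fun s => -X s) (mem_univ r)]
  have e3 : ∏ s, ((X r)⁻¹ - β s * (X s)⁻¹) = (X r)⁻¹ * (∏ s ∈ univ.erase r, (X r)⁻¹) *
      ∏ s, (1 - β s * X r / X s) := by
    rw [mul_prod_erase univ (fun _ => (X r)⁻¹) (mem_univ r), ← prod_mul_distrib]
    exact prod_congr rfl fun s _ => by have := hX0 s; have := hX0 r; field_simp
  rw [e3]
  have e4 : (∏ s ∈ univ.erase r, -X s) * (∏ s ∈ univ.erase r, (X r)⁻¹) *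
      (∏ s ∈ univ.erase r, (0 - (X s)⁻¹) / ((X r)⁻¹ - (X s)⁻¹)) =
      (∏ s ∈ univ.erase r, (1 - X r / X s))⁻¹ := by
    rw [← prod_mul_distrib, ← prod_mul_distrib, ← prod_inv_distrib]
    refine prod_congr rfl fun s hs => ?_
    have := hX0 s; have := hX0 r
    have h1 : X s - X r ≠ 0 := sub_ne_zero.2 fun e => (ne_of_mem_erase hs) (hX e)
    have h2 : (X r)⁻¹ - (X s)⁻¹ ≠ 0 := sub_ne_zero.2 fun e => (ne_of_mem_erase hs) (hinj e.symm)
    have h3 : 1 - X r / X s ≠ 0 := by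
      rw [one_sub_div (hX0 s)]
      exact div_ne_zero h1 (hX0 s)
    field_simp
    ring
  rw [div_eq_mul_inv, ← e4]
  linear_combination (-1 : ℂ) * (∏ s, (1 - β s * X r / X s)) *
    (∏ s ∈ univ.erase r, -X s) * (∏ s ∈ univ.erase r, (X r)⁻¹) *
    (∏ s ∈ univ.erase r, (0 - (X s)⁻¹) / ((X r)⁻¹ - (X s)⁻¹)) * mul_inv_cancel₀ (hX0 r)

end Interpolation

/-- The points `x_r p ^ (k_r)`. -/
def shift (p : ℂ) {n : ℕ} (x : Fin n → ℂ) (k : Fin n → ℕ) (r : Fin n) : ℂ := x r * p ^ k r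

/-- The Vandermonde product `∏_{r < s} (X_r - X_s)`. -/
def diffProd {n : ℕ} (X : Fin n → ℂ) : ℂ := ∏ r, ∏ s ∈ Ioi r, (X r - X s)

/-- The product `∏_{r,s} (a_s x_r / x_s; p)_{k_r}`. -/
noncomputable def gridFac (p : ℂ) {n : ℕ} (a x : Fin n → ℂ) (k : Fin n → ℕ) : ℂ :=
  ∏ r, ∏ s, rfac (a s * x r / x s) p (k r)

/-- The summand of the `A_n` `q`-binomial series without the power of the argument. -/
noncomputable def binTerm (p : ℂ) {n : ℕ} (a x : Fin n → ℂ) (k : Fin n → ℕ) : ℂ :=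
  diffProd (shift p x k) / diffProd x * (gridFac p a x k / gridFac p (fun _ => p) x k)

/-- The summand of the second `A_n` `q`-binomial series without the power of the argument. -/
noncomputable def dualTerm (p : ℂ) {n : ℕ} (a x : Fin n → ℂ) (k : Fin n → ℕ) : ℂ :=
  binTerm p a x k * p ^ e2 k * ∏ r, (x r ^ k r)⁻¹

theorem rfac_succ (A p : ℂ) (k : ℕ) : rfac A p (k + 1) = rfac A p k * (1 - A * p ^ k) :=
  prod_range_succ _ _

theorem rfac_succ' (A p : ℂ) (k : ℕ) : rfac A p (k + 1) = (1 - A) * rfac (A * p) p k := by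
  rw [rfac, prod_range_succ', rfac, mul_comm, pow_zero, mul_one]
  congr 1
  exact prod_congr rfl fun i _ => by ring

@[simp] theorem rfac_zero (A p : ℂ) : rfac A p 0 = 1 := rfl

section Pairs

variable {n : ℕ}

@[to_additive]
theorem prod_prod_Ioi_eq {M : Type*} [CommMonoid M] (f : Fin n → Fin n → M) (r : Fin n) :
    ∏ i, ∏ j ∈ Ioi i, f i j = (∏ j ∈ univ.erase r, if r < j then f r j else f j r) *
      ∏ i ∈ univ.erase r, ∏ j ∈ (Ioi i).erase r, f i j := by
  have h1 : ∏ i ∈ univ.erase r, ∏ j ∈ Ioi i, f i j =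
      (∏ i ∈ univ.erase r, if i < r then f i r else 1) *
        ∏ i ∈ univ.erase r, ∏ j ∈ (Ioi i).erase r, f i j := by
    rw [← prod_mul_distrib]
    refine prod_congr rfl fun i _ => ?_
    split_ifs with h
    · rw [mul_prod_erase _ _ (mem_Ioi.2 h)]
    · rw [erase_eq_of_notMem (by simpa using h), one_mul]
  have h2 : ∏ j ∈ Ioi r, f r j = ∏ j ∈ univ.erase r, if r < j then f r j else 1 := by
    rw [← prod_filter]
    congr 1
    ext j
    simp only [mem_Ioi, mem_filter, mem_erase, mem_univ, and_true]
    exact ⟨fun h => ⟨h.ne', h⟩, fun h => h.2⟩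
  rw [← mul_prod_erase univ _ (mem_univ r), h1, h2, ← mul_assoc, ← prod_mul_distrib]
  congr 1
  refine prod_congr rfl fun j hj => ?_
  rcases lt_or_gt_of_ne (ne_of_mem_erase hj) with h | h
  · simp [h, h.not_gt]
  · simp [h, h.not_gt]

theorem diffProd_mul_prod_erase {X Y : Fin n → ℂ} (r : Fin n) (h : ∀ s, s ≠ r → Y s = X s) :
    diffProd Y * ∏ s ∈ univ.erase r, (X r - X s) =
      diffProd X * ∏ s ∈ univ.erase r, (Y r - X s) := by
  have e : ∏ i ∈ univ.erase r, ∏ j ∈ (Ioi i).erase r, (Y i - Y j) =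
      ∏ i ∈ univ.erase r, ∏ j ∈ (Ioi i).erase r, (X i - X j) :=
    prod_congr rfl fun i hi => prod_congr rfl fun j hj => by
      rw [h i (ne_of_mem_erase hi), h j (ne_of_mem_erase hj)]
  have e' : (∏ j ∈ univ.erase r, if r < j then Y r - Y j else Y j - Y r) *
      (∏ s ∈ univ.erase r, (X r - X s)) =
      (∏ j ∈ univ.erase r, if r < j then X r - X j else X j - X r) *
      ∏ s ∈ univ.erase r, (Y r - X s) := by
    rw [← prod_mul_distrib, ← prod_mul_distrib]
    refine prod_congr rfl fun j hj => ?_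
    rw [h j (ne_of_mem_erase hj)]
    split_ifs <;> ring
  rw [diffProd, diffProd, prod_prod_Ioi_eq _ r, prod_prod_Ioi_eq (fun i j => X i - X j) r, e,
    mul_right_comm, e', mul_right_comm]

theorem diffProd_ne_zero {X : Fin n → ℂ} (hX : Function.Injective X) : diffProd X ≠ 0 :=
  prod_ne_zero_iff.2 fun _ _ => prod_ne_zero_iff.2 fun _ hs =>
    sub_ne_zero.2 fun e => (mem_Ioi.1 hs).ne (hX e)

end Pairs

section Step

variable {n : ℕ} {p : ℂ} {x : Fin n → ℂ}

theorem size_add_single (k : Fin n → ℕ) (r : Fin n) : size (k + Pi.single r 1) = size k + 1 := by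
  simp [size, sum_add_distrib]

theorem shift_add_single_self (k : Fin n → ℕ) (r : Fin n) :
    shift p x (k + Pi.single r 1) r = p * shift p x k r := by
  simp [shift, pow_succ]; ring

theorem shift_add_single_of_ne (k : Fin n → ℕ) {r s : Fin n} (h : s ≠ r) :
    shift p x (k + Pi.single r 1) s = shift p x k s := by
  simp [shift, h]

theorem shift_ne_zero (hp : p ≠ 0) (hx0 : ∀ r, x r ≠ 0) (k : Fin n → ℕ) (r : Fin n) :
    shift p x k r ≠ 0 := mul_ne_zero (hx0 r) (pow_ne_zero _ hp)

theorem shift_injective (hp : p ≠ 0) (hx : ∀ r s, r ≠ s → ∀ i : ℕ, x r * p ^ i ≠ x s)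
    (k : Fin n → ℕ) : Function.Injective (shift p x k) := by
  have main : ∀ r s, r ≠ s → k s ≤ k r → shift p x k r ≠ shift p x k s := by
    intro r s hrs hk e
    obtain ⟨d, hd⟩ := Nat.exists_eq_add_of_le hk
    refine hx r s hrs d (mul_right_cancel₀ (pow_ne_zero (k s) hp) ?_)
    rw [mul_assoc, ← pow_add, add_comm d, ← hd]
    exact e
  intro r s e
  by_contra hrs
  rcases le_total (k s) (k r) with h | h
  · exact main r s hrs h e
  · exact main s r (Ne.symm hrs) h e.symm

theorem gridFac_add_single (a x : Fin n → ℂ) (k : Fin n → ℕ) (r : Fin n) :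
    gridFac p a x (k + Pi.single r 1) =
      gridFac p a x k * ∏ s, (1 - a s * shift p x k r / x s) := by
  rw [gridFac, gridFac, ← mul_prod_erase univ _ (mem_univ r),
    ← mul_prod_erase univ (fun i => ∏ s, rfac (a s * x i / x s) p (k i)) (mem_univ r),
    mul_right_comm, ← prod_mul_distrib]
  congr 1
  · refine prod_congr rfl fun s _ => ?_
    simp only [Pi.add_apply, Pi.single_eq_same, rfac_succ, shift]
    ring
  · refine prod_congr rfl fun i hi => prod_congr rfl fun s _ => ?_
    simp [ne_of_mem_erase hi]

theorem one_sub_pow_ne_zero (hp1 : ‖p‖ < 1) (i : ℕ) : 1 - p ^ (i + 1) ≠ 0 := by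
  refine sub_ne_zero.2 fun e => ?_
  have := congrArg norm e
  rw [norm_one, norm_pow] at this
  exact (pow_lt_one₀ (norm_nonneg p) hp1 (Nat.succ_ne_zero i)).ne this.symm

theorem one_sub_base_mul_ne_zero (hp1 : ‖p‖ < 1) (hx0 : ∀ r, x r ≠ 0)
    (hx : ∀ r s, r ≠ s → ∀ i : ℕ, x r * p ^ i ≠ x s) (r s : Fin n) (i : ℕ) :
    1 - p * x r / x s * p ^ i ≠ 0 := by
  rcases eq_or_ne r s with rfl | h
  · have := one_sub_pow_ne_zero hp1 i
    rwa [mul_div_assoc, div_self (hx0 r), mul_one, ← pow_succ']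
  · intro e
    refine hx r s h (i + 1) ?_
    have := hx0 s
    field_simp at e
    rw [pow_succ]
    linear_combination -e

theorem gridFac_base_ne_zero (hp1 : ‖p‖ < 1) (hx0 : ∀ r, x r ≠ 0)
    (hx : ∀ r s, r ≠ s → ∀ i : ℕ, x r * p ^ i ≠ x s) (k : Fin n → ℕ) :
    gridFac p (fun _ => p) x k ≠ 0 :=
  prod_ne_zero_iff.2 fun r _ => prod_ne_zero_iff.2 fun s _ => prod_ne_zero_iff.2 fun i _ =>
    one_sub_base_mul_ne_zero hp1 hx0 hx r s i

theorem injective_of_mul_pow_ne (hx : ∀ r s, r ≠ s → ∀ i : ℕ, x r * p ^ i ≠ x s) :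
    Function.Injective x := fun r s e => by
  by_contra h
  exact hx r s h 0 (by simpa using e)

/-- The quotient of two neighbouring terms of the `q`-binomial series. -/
theorem binTerm_add_single (hp : p ≠ 0) (hp1 : ‖p‖ < 1) (hx0 : ∀ r, x r ≠ 0)
    (hx : ∀ r s, r ≠ s → ∀ i : ℕ, x r * p ^ i ≠ x s) (a : Fin n → ℂ) (k : Fin n → ℕ)
    (r : Fin n) :
    binTerm p a x (k + Pi.single r 1) * ∏ s, (1 - p * shift p x k r / x s) =
      binTerm p a x k * (∏ s, (1 - a s * shift p x k r / x s)) *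
        ((∏ s ∈ univ.erase r, (1 - p * shift p x k r / shift p x k s)) /
          ∏ s ∈ univ.erase r, (1 - shift p x k r / shift p x k s)) := by
  have hD := diffProd_mul_prod_erase (X := shift p x k) (Y := shift p x (k + Pi.single r 1)) r
    fun s hs => shift_add_single_of_ne k hs
  have hX0 := shift_ne_zero hp hx0 k
  have hinj := shift_injective hp hx k
  rw [shift_add_single_self] at hD
  have hne : ∏ s ∈ univ.erase r, (shift p x k r - shift p x k s) ≠ 0 :=
    prod_ne_zero_iff.2 fun s hs => sub_ne_zero.2 fun e => (ne_of_mem_erase hs) (hinj e).symm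
  have hQ : (∏ s ∈ univ.erase r, (1 - p * shift p x k r / shift p x k s)) /
      (∏ s ∈ univ.erase r, (1 - shift p x k r / shift p x k s)) =
      (∏ s ∈ univ.erase r, (p * shift p x k r - shift p x k s)) /
      ∏ s ∈ univ.erase r, (shift p x k r - shift p x k s) := by
    rw [← prod_div_distrib, ← prod_div_distrib]
    refine prod_congr rfl fun s hs => ?_
    have h0 := hX0 s
    rw [← neg_div_neg_eq (p * shift p x k r - shift p x k s), neg_sub, neg_sub,
      ← div_div_div_cancel_right₀ h0 (shift p x k s - p * shift p x k r), one_sub_div h0,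
      one_sub_div h0]
  have hG := gridFac_base_ne_zero hp1 hx0 hx k
  have hG' := gridFac_base_ne_zero hp1 hx0 hx (k + Pi.single r 1)
  rw [gridFac_add_single] at hG'
  have hlast := right_ne_zero_of_mul hG'
  have hx' := diffProd_ne_zero (injective_of_mul_pow_ne hx)
  rw [hQ, binTerm, binTerm, gridFac_add_single, gridFac_add_single]
  rw [eq_div_of_mul_eq hne hD]
  field_simp

end Step

section Coefficients

variable {n : ℕ} {p : ℂ} {x : Fin n → ℂ}

theorem mem_piAntidiag_univ {N : ℕ} {k : Fin n → ℕ} : k ∈ piAntidiag univ N ↔ size k = N := by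
  simp [size]

theorem exists_eq_add_single {k : Fin n → ℕ} {r : Fin n} (h : k r ≠ 0) :
    ∃ i : Fin n → ℕ, k = i + Pi.single r 1 := by
  refine ⟨k - Pi.single r 1, (tsub_add_cancel_of_le fun s => ?_).symm⟩
  rcases eq_or_ne s r with rfl | hs
  · simpa using Nat.one_le_iff_ne_zero.2 h
  · simp [hs]

theorem sum_piAntidiag_succ (f : Fin n → (Fin n → ℕ) → ℂ) (hf : ∀ r k, k r = 0 → f r k = 0)
    (N : ℕ) : ∑ k ∈ piAntidiag univ (N + 1), ∑ r, f r k =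
      ∑ k ∈ piAntidiag univ N, ∑ r, f r (k + Pi.single r 1) := by
  rw [sum_comm, sum_comm (s := piAntidiag univ N)]
  refine sum_congr rfl fun r _ => ?_
  symm
  refine sum_of_injOn (fun k => k + Pi.single r 1) (fun k _ l _ h => add_right_cancel h) ?_ ?_
    fun _ _ => rfl
  · intro k hk
    rw [mem_coe, mem_piAntidiag_univ] at hk ⊢
    rw [size_add_single, hk]
  · intro k hk hk'
    refine hf r k ?_
    by_contra h
    obtain ⟨i, rfl⟩ := exists_eq_add_single h
    refine hk' ⟨i, ?_, rfl⟩
    rw [mem_coe, mem_piAntidiag_univ]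
    rw [mem_piAntidiag_univ, size_add_single] at hk
    exact Nat.succ_injective hk

theorem prod_pow_eq_pow_size (p : ℂ) (k : Fin n → ℕ) : ∏ s, p ^ k s = p ^ size k :=
  prod_pow_eq_pow_sum _ _ _

theorem sum_shift_eq_one_sub (hp : p ≠ 0) (hx0 : ∀ r, x r ≠ 0)
    (hx : ∀ r s, r ≠ s → ∀ i : ℕ, x r * p ^ i ≠ x s) (a : Fin n → ℂ) (k : Fin n → ℕ) :
    ∑ r, (∏ s, (1 - a s * shift p x k r / x s)) /
      ∏ s ∈ univ.erase r, (1 - shift p x k r / shift p x k s) = 1 - (∏ s, a s) * p ^ size k := by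
  rw [← prod_pow_eq_pow_size, ← prod_mul_distrib,
    ← sum_prod_div_prod_eq_one_sub_prod (shift_injective hp hx k) (shift_ne_zero hp hx0 k)]
  refine sum_congr rfl fun r _ => ?_
  congr 1
  refine prod_congr rfl fun s _ => ?_
  have := hx0 s
  have := pow_ne_zero (k s) hp
  rw [shift, shift]
  field_simp

/-- The recurrence for the coefficients of the `A_n` `q`-binomial series. -/
theorem sum_binTerm_succ (hp : p ≠ 0) (hp1 : ‖p‖ < 1) (hx0 : ∀ r, x r ≠ 0)
    (hx : ∀ r s, r ≠ s → ∀ i : ℕ, x r * p ^ i ≠ x s) (a : Fin n → ℂ) (N : ℕ) :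
    (1 - p ^ (N + 1)) * ∑ k ∈ piAntidiag univ (N + 1), binTerm p a x k =
      (1 - (∏ s, a s) * p ^ N) * ∑ k ∈ piAntidiag univ N, binTerm p a x k := by
  let V : Fin n → (Fin n → ℕ) → ℂ := fun r k => binTerm p a x k *
    ((∏ s, (1 - 1 * shift p x k r / x s)) /
      ∏ s ∈ univ.erase r, (1 - shift p x k r / shift p x k s))
  have h := sum_piAntidiag_succ V (fun r k hk => ?_) N
  · have h1 : ∀ k ∈ piAntidiag univ (N + 1), ∑ r, V r k = (1 - p ^ (N + 1)) * binTerm p a x k := by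
      intro k hk
      rw [← mul_sum, sum_shift_eq_one_sub hp hx0 hx (fun _ => 1), prod_const_one, one_mul,
        mem_piAntidiag_univ.1 hk, mul_comm]
    have h2 : ∀ k ∈ piAntidiag univ N, ∑ r, V r (k + Pi.single r 1) =
        (1 - (∏ s, a s) * p ^ N) * binTerm p a x k := by
      intro k hk
      rw [← mem_piAntidiag_univ.1 hk, ← sum_shift_eq_one_sub hp hx0 hx a, mul_comm, mul_sum]
      refine sum_congr rfl fun r _ => ?_
      have hX0 := shift_ne_zero hp hx0 k
      have hinj := shift_injective hp hx (k + Pi.single r 1)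
      have hE : ∏ s ∈ univ.erase r, (1 - shift p x (k + Pi.single r 1) r /
          shift p x (k + Pi.single r 1) s) =
          ∏ s ∈ univ.erase r, (1 - p * shift p x k r / shift p x k s) :=
        prod_congr rfl fun s hs => by
          rw [shift_add_single_self, shift_add_single_of_ne k (ne_of_mem_erase hs)]
      have hne : ∏ s ∈ univ.erase r, (1 - p * shift p x k r / shift p x k s) ≠ 0 := by
        rw [← hE]
        refine prod_ne_zero_iff.2 fun s hs e => (ne_of_mem_erase hs) (hinj ?_)
        have h0 := shift_ne_zero hp hx0 (k + Pi.single r 1) s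
        rw [one_sub_div h0, div_eq_zero_iff, or_iff_left h0] at e
        exact sub_eq_zero.1 e
      simp only [V]
      rw [hE, shift_add_single_self]
      simp only [one_mul]
      rw [← mul_div_assoc, binTerm_add_single hp hp1 hx0 hx]
      generalize ∏ s ∈ univ.erase r, (1 - p * shift p x k r / shift p x k s) = E at hne ⊢
      generalize ∏ s ∈ univ.erase r, (1 - shift p x k r / shift p x k s) = D
      generalize ∏ s, (1 - a s * shift p x k r / x s) = A
      field_simp
    rw [sum_congr rfl h1, sum_congr rfl h2, ← mul_sum, ← mul_sum] at h
    exact h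
  · simp only [V]
    rw [prod_eq_zero (mem_univ r), zero_div, mul_zero]
    rw [shift, hk, pow_zero, mul_one, one_mul, div_self (hx0 r), sub_self]

theorem e2_add_single (k : Fin n → ℕ) (r : Fin n) :
    e2 (k + Pi.single r 1) = e2 k + ∑ u ∈ univ.erase r, k u := by
  rw [e2, e2, sum_sum_Ioi_eq _ r, sum_sum_Ioi_eq (fun i j => k i * k j) r, add_right_comm]
  refine congrArg₂ (fun u v : ℕ => u + v) ?_
    (sum_congr rfl fun i hi => sum_congr rfl fun j hj => ?_)
  · rw [← sum_add_distrib]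
    refine sum_congr rfl fun j hj => ?_
    simp only [Pi.add_apply, Pi.single_eq_same, Pi.single_eq_of_ne (ne_of_mem_erase hj)]
    split_ifs <;> ring
  · simp [ne_of_mem_erase hi, ne_of_mem_erase hj]

theorem prod_inv_pow_add_single (x : Fin n → ℂ) (k : Fin n → ℕ) (r : Fin n) :
    ∏ u, (x u ^ (k + Pi.single r 1 : Fin n → ℕ) u)⁻¹ = (∏ u, (x u ^ k u)⁻¹) * (x r)⁻¹ := by
  rw [← mul_prod_erase univ _ (mem_univ r), ← mul_prod_erase univ (fun u => (x u ^ k u)⁻¹)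
    (mem_univ r), mul_right_comm]
  congr 1
  · simp [pow_succ, mul_comm]
  · exact prod_congr rfl fun u hu => by simp [ne_of_mem_erase hu]

/-- The Lagrange weight in the recurrence of the second `q`-binomial series. -/
noncomputable def dualWeight (p : ℂ) {n : ℕ} (b y : Fin n → ℂ) (s r : Fin n) (k : Fin n → ℕ) : ℂ :=
  (∏ u ∈ univ.erase s, (1 - b u * shift p y k r / y u)) /
    ∏ u ∈ univ.erase r, (1 - shift p y k r / shift p y k u)

theorem sum_dualWeight (hp : p ≠ 0) (hx0 : ∀ r, x r ≠ 0)
    (hx : ∀ r s, r ≠ s → ∀ i : ℕ, x r * p ^ i ≠ x s) (b : Fin n → ℂ) (s : Fin n)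
    (k : Fin n → ℕ) : ∑ r, dualWeight p b x s r k = 1 := by
  have h := sum_shift_eq_one_sub hp hx0 hx (Function.update b s 0) k
  rw [prod_eq_zero (mem_univ s) (Function.update_self s 0 b), zero_mul, sub_zero] at h
  rw [← h]
  refine sum_congr rfl fun r _ => ?_
  rw [dualWeight, ← mul_prod_erase univ _ (mem_univ s), Function.update_self, zero_mul, zero_div,
    sub_zero, one_mul]
  congr 1
  exact prod_congr rfl fun u hu => by rw [Function.update_of_ne (ne_of_mem_erase hu)]

/-- The effect of `b_s ↦ b_s p` on a numerator product. -/
theorem gridFac_mul_prod_eq (b x : Fin n → ℂ) (s : Fin n) (k : Fin n → ℕ) :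
    gridFac p b x k * ∏ r, (1 - b s / x s * shift p x k r) =
      gridFac p (Function.update b s (b s * p)) x k * ∏ r, (1 - b s / x s * x r) := by
  rw [gridFac, gridFac, ← prod_mul_distrib, ← prod_mul_distrib]
  refine prod_congr rfl fun r _ => ?_
  rw [← mul_prod_erase univ _ (mem_univ s), ← mul_prod_erase univ
    (fun u => rfac (Function.update b s (b s * p) u * x r / x u) p (k r)) (mem_univ s),
    Function.update_self]
  have e : ∏ u ∈ univ.erase s, rfac (Function.update b s (b s * p) u * x r / x u) p (k r) =
      ∏ u ∈ univ.erase s, rfac (b u * x r / x u) p (k r) :=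
    prod_congr rfl fun u hu => by rw [Function.update_of_ne (ne_of_mem_erase hu)]
  have h1 := (rfac_succ (b s * x r / x s) p (k r)).symm.trans (rfac_succ' _ _ _)
  have e1 : b s * x r / x s * p = b s * p * x r / x s := by ring
  have e2 : b s / x s * shift p x k r = b s * x r / x s * p ^ k r := by rw [shift]; ring
  have e3 : b s / x s * x r = b s * x r / x s := by ring
  rw [e1] at h1
  rw [e, e2, e3, mul_right_comm, h1]
  ring

theorem dualTerm_add_single (hp : p ≠ 0) (hp1 : ‖p‖ < 1) (hx0 : ∀ r, x r ≠ 0)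
    (hx : ∀ r s, r ≠ s → ∀ i : ℕ, x r * p ^ i ≠ x s) (b : Fin n → ℂ) (s : Fin n)
    (k : Fin n → ℕ) (r : Fin n) :
    dualTerm p (Function.update b s (b s * p)) x (k + Pi.single r 1) *
        ((∏ u, (p * shift p x k r - x u)) /
          ∏ u ∈ univ.erase r, (p * shift p x k r - shift p x k u)) =
      -((1 - b s / x s * (p * shift p x k r)) *
        (dualTerm p (Function.update b s (b s * p)) x k * dualWeight p b x s r k)) := by
  have hX0 := shift_ne_zero hp hx0 k
  have hB := binTerm_add_single hp hp1 hx0 hx (Function.update b s (b s * p)) k r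
  have e1 : ∏ u, (1 - Function.update b s (b s * p) u * shift p x k r / x u) =
      (1 - b s / x s * (p * shift p x k r)) *
        ∏ u ∈ univ.erase s, (1 - b u * shift p x k r / x u) := by
    rw [← mul_prod_erase univ _ (mem_univ s), Function.update_self]
    congr 1
    · ring
    · exact prod_congr rfl fun u hu => by rw [Function.update_of_ne (ne_of_mem_erase hu)]
  have e4 : ∏ u, (1 - p * shift p x k r / x u) =
      (∏ u, (p * shift p x k r - x u)) * ∏ u, (-(x u)⁻¹) := by
    rw [← prod_mul_distrib]
    exact prod_congr rfl fun u _ => by have := hx0 u; field_simp; ring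
  have e3 : ∏ u ∈ univ.erase r, (1 - p * shift p x k r / shift p x k u) =
      (∏ u ∈ univ.erase r, (p * shift p x k r - shift p x k u)) *
        ((∏ u ∈ univ.erase r, (-(x u)⁻¹)) * (p ^ ∑ u ∈ univ.erase r, k u)⁻¹) := by
    rw [← prod_pow_eq_pow_sum, ← prod_inv_distrib, ← prod_mul_distrib, ← prod_mul_distrib]
    refine prod_congr rfl fun u _ => ?_
    have h0 := hX0 u
    rw [one_sub_div h0, shift, shift]
    have := hx0 u
    have := pow_ne_zero (k u) hp
    field_simp
    ring
  have hE : ∏ u ∈ univ.erase r, (p * shift p x k r - shift p x k u) ≠ 0 := by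
    refine prod_ne_zero_iff.2 fun u hu e => (ne_of_mem_erase hu) ?_
    refine shift_injective hp hx (k + Pi.single r 1) ?_
    rw [shift_add_single_self, shift_add_single_of_ne k (ne_of_mem_erase hu)]
    exact (sub_eq_zero.1 e).symm
  have hI : ∏ u ∈ univ.erase r, (-(x u)⁻¹) ≠ 0 :=
    prod_ne_zero_iff.2 fun u _ => neg_ne_zero.2 (inv_ne_zero (hx0 u))
  have hpp : p ^ ∑ u ∈ univ.erase r, k u ≠ 0 := pow_ne_zero _ hp
  rw [e1, e4, e3, ← mul_prod_erase univ (fun u => -(x u)⁻¹) (mem_univ r)] at hB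
  rw [dualTerm, dualTerm, e2_add_single, prod_inv_pow_add_single, dualWeight, pow_add]
  set S := ∏ u ∈ univ.erase r, (p * shift p x k r - shift p x k u)
  set I := ∏ u ∈ univ.erase r, (-(x u)⁻¹)
  set P := p ^ ∑ u ∈ univ.erase r, k u
  set T := binTerm p (Function.update b s (b s * p)) x (k + Pi.single r 1)
  set U := ∏ u, (p * shift p x k r - x u)
  have hB' : T * U * (x r)⁻¹ * P = -(binTerm p (Function.update b s (b s * p)) x k *
      ((1 - b s / x s * (p * shift p x k r)) *
        ∏ u ∈ univ.erase s, (1 - b u * shift p x k r / x u)) * (S /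
      ∏ u ∈ univ.erase r, (1 - shift p x k r / shift p x k u))) := by
    refine mul_right_cancel₀ hI ?_
    have : T * U * (x r)⁻¹ * P * I = -(T * (U * (-(x r)⁻¹ * I))) * P := by ring
    rw [this, hB]
    field_simp
  calc _ = T * U * (x r)⁻¹ * P * (p ^ e2 k * (∏ u, (x u ^ k u)⁻¹)) / S := by ring
    _ = _ := by rw [hB']; field_simp

theorem continuous_gridFac (x : Fin n → ℂ) (k : Fin n → ℕ) :
    Continuous fun b : Fin n → ℂ => gridFac p b x k := by
  unfold gridFac rfac
  fun_prop

theorem continuous_dualTerm (x : Fin n → ℂ) (k : Fin n → ℕ) :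
    Continuous fun b : Fin n → ℂ => dualTerm p b x k := by
  unfold dualTerm binTerm
  have := continuous_gridFac (p := p) x k
  fun_prop

theorem continuous_dualWeight (x : Fin n → ℂ) (s r : Fin n) (k : Fin n → ℕ) :
    Continuous fun b : Fin n → ℂ => dualWeight p b x s r k := by
  unfold dualWeight
  fun_prop

theorem dualTerm_sub_of_ne_zero (hp : p ≠ 0) (hp1 : ‖p‖ < 1) (hx0 : ∀ r, x r ≠ 0)
    (hx : ∀ r s, r ≠ s → ∀ i : ℕ, x r * p ^ i ≠ x s) (b : Fin n → ℂ) (s : Fin n)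
    (k : Fin n → ℕ) (hb : ∀ r, 1 - b s / x s * shift p x k r ≠ 0) :
    dualTerm p b x k - dualTerm p (Function.update b s (b s * p)) x k =
      ∑ r, if k r = 0 then 0 else -(b s / x s) *
        (dualTerm p (Function.update b s (b s * p)) x (k - Pi.single r 1) *
          dualWeight p b x s r (k - Pi.single r 1)) := by
  have hP : ∏ r, (1 - b s / x s * shift p x k r) ≠ 0 := prod_ne_zero_iff.2 fun r _ => hb r
  have hT : dualTerm p b x k * ∏ r, (1 - b s / x s * shift p x k r) =
      dualTerm p (Function.update b s (b s * p)) x k * ∏ r, (1 - b s / x s * x r) := by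
    simp only [dualTerm, binTerm]
    linear_combination diffProd (shift p x k) / diffProd x / gridFac p (fun _ => p) x k *
      p ^ e2 k * (∏ r, (x r ^ k r)⁻¹) * gridFac_mul_prod_eq (p := p) b x s k
  refine mul_right_cancel₀ hP ?_
  rw [sub_mul, hT, prod_one_sub_mul_eq (shift_injective hp hx k) x, mul_add, add_sub_cancel_left,
    mul_sum, sum_mul]
  refine sum_congr rfl fun r _ => ?_
  split_ifs with h
  · rw [prod_eq_zero (mem_univ r)]
    · ring
    · rw [shift, h, pow_zero, mul_one, sub_self]
  obtain ⟨i, hi⟩ := exists_eq_add_single h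
  have hD := dualTerm_add_single hp hp1 hx0 hx b s i r
  have e : ∏ u ∈ univ.erase r, (shift p x k r - shift p x k u) =
      ∏ u ∈ univ.erase r, (p * shift p x i r - shift p x i u) :=
    prod_congr rfl fun u hu => by
      rw [hi, shift_add_single_self, shift_add_single_of_ne i (ne_of_mem_erase hu)]
  have hr : shift p x k r = p * shift p x i r := by rw [hi, shift_add_single_self]
  have hi' : k - Pi.single r 1 = i := by rw [hi, add_tsub_cancel_right]
  rw [hi', ← mul_prod_erase univ (fun u => 1 - b s / x s * shift p x k u) (mem_univ r),
    prod_div_distrib, e, hr]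
  rw [← hi] at hD
  linear_combination (b s / x s) *
    (∏ u ∈ univ.erase r, (1 - b s / x s * shift p x k u)) * hD

theorem dualTerm_sub (hp : p ≠ 0) (hp1 : ‖p‖ < 1) (hx0 : ∀ r, x r ≠ 0)
    (hx : ∀ r s, r ≠ s → ∀ i : ℕ, x r * p ^ i ≠ x s) (b : Fin n → ℂ) (s : Fin n)
    (k : Fin n → ℕ) :
    dualTerm p b x k - dualTerm p (Function.update b s (b s * p)) x k =
      ∑ r, if k r = 0 then 0 else -(b s / x s) *
        (dualTerm p (Function.update b s (b s * p)) x (k - Pi.single r 1) *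
          dualWeight p b x s r (k - Pi.single r 1)) := by
  have hc : ∀ f : ℂ → ℂ, Continuous f → Continuous fun v => Function.update b s (f v) :=
    fun f hf => continuous_const.update s hf
  have hd : Dense (Set.range fun r => x s / shift p x k r)ᶜ :=
    (Set.finite_range _).countable.dense_compl ℂ
  have hL : Continuous fun v : ℂ => dualTerm p (Function.update b s v) x k -
      dualTerm p (Function.update b s (v * p)) x k :=
    ((continuous_dualTerm x k).comp (hc _ continuous_id)).sub
      ((continuous_dualTerm x k).comp (hc _ (continuous_id.mul continuous_const)))
  have hR : Continuous fun v : ℂ => ∑ r, if k r = 0 then 0 else -(v / x s) *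
      (dualTerm p (Function.update b s (v * p)) x (k - Pi.single r 1) *
        dualWeight p (Function.update b s v) x s r (k - Pi.single r 1)) := by
    refine continuous_finsetSum _ fun r _ => ?_
    split_ifs
    · exact continuous_const
    · exact (continuous_id.div_const _).neg.mul
        (((continuous_dualTerm x _).comp (hc _ (continuous_id.mul continuous_const))).mul
          ((continuous_dualWeight x s r _).comp (hc _ continuous_id)))
  have h := congrFun (Continuous.ext_on hd hL hR fun v hv => ?_) (b s)
  · simpa only [Function.update_eq_self] using h
  · have h := dualTerm_sub_of_ne_zero hp hp1 hx0 hx (Function.update b s v) s k fun r e => hv ⟨r, ?_⟩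
    · simpa only [Function.update_self, Function.update_idem] using h
    · have := hx0 s
      have := shift_ne_zero hp hx0 k r
      rw [Function.update_self] at e
      field_simp at e ⊢
      linear_combination e

/-- The recurrence for the coefficients of the second `A_n` `q`-binomial series. -/
theorem sum_dualTerm_succ (hp : p ≠ 0) (hp1 : ‖p‖ < 1) (hx0 : ∀ r, x r ≠ 0)
    (hx : ∀ r s, r ≠ s → ∀ i : ℕ, x r * p ^ i ≠ x s) (b : Fin n → ℂ) (s : Fin n) (N : ℕ) :
    ∑ k ∈ piAntidiag univ (N + 1), dualTerm p b x k =
      ∑ k ∈ piAntidiag univ (N + 1), dualTerm p (Function.update b s (b s * p)) x k -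
        b s / x s * ∑ k ∈ piAntidiag univ N, dualTerm p (Function.update b s (b s * p)) x k := by
  rw [sub_eq_add_neg, ← sub_eq_iff_eq_add', ← sum_sub_distrib, sum_congr rfl fun k _ =>
    dualTerm_sub hp hp1 hx0 hx b s k, sum_piAntidiag_succ _ fun r k hk => if_pos hk, mul_sum,
    ← sum_neg_distrib]
  refine sum_congr rfl fun k _ => ?_
  have h : ∀ r : Fin n, (k + Pi.single r 1 : Fin n → ℕ) r ≠ 0 := fun r => by simp
  simp only [h, if_false, add_tsub_cancel_right]
  rw [← mul_sum, ← mul_sum, sum_dualWeight hp hx0 hx, mul_one, neg_mul]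

end Coefficients

section Products

variable {p : ℂ}

theorem summable_norm_mul_pow (hp1 : ‖p‖ < 1) (A : ℂ) : Summable fun i : ℕ => ‖-(A * p ^ i)‖ := by
  simp only [norm_neg, norm_mul, norm_pow]
  exact (summable_geometric_of_lt_one (norm_nonneg p) hp1).mul_left _

theorem tendsto_rfac (hp1 : ‖p‖ < 1) (A : ℂ) :
    Tendsto (fun k => rfac A p k) atTop (𝓝 (rfacInf A p)) := by
  simp only [rfac, rfacInf, sub_eq_add_neg]
  exact (multipliable_one_add_of_summable (summable_norm_mul_pow hp1 A)).hasProd.tendsto_prod_nat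

theorem rfacInf_ne_zero (hp1 : ‖p‖ < 1) {A : ℂ} (hA : ∀ i : ℕ, 1 - A * p ^ i ≠ 0) :
    rfacInf A p ≠ 0 := by
  simp only [rfacInf, sub_eq_add_neg] at hA ⊢
  exact tprod_one_add_ne_zero_of_summable hA (summable_norm_mul_pow hp1 A)

theorem rfacInf_ne_zero_of_norm_lt_one (hp1 : ‖p‖ < 1) {A : ℂ} (hA : ‖A‖ < 1) :
    rfacInf A p ≠ 0 := by
  refine rfacInf_ne_zero hp1 fun i e => ?_
  have h := congrArg norm (sub_eq_zero.1 e)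
  rw [norm_one, norm_mul, norm_pow] at h
  exact (mul_lt_one_of_nonneg_of_lt_one_left (norm_nonneg A) hA
    (pow_le_one₀ (norm_nonneg p) hp1.le)).ne h.symm

theorem norm_rfac_le (hp1 : ‖p‖ < 1) {A : ℂ} {R : ℝ} (hA : ‖A‖ ≤ R) (k : ℕ) :
    ‖rfac A p k‖ ≤ Real.exp (R * (1 - ‖p‖)⁻¹) := by
  have hR : 0 ≤ R := (norm_nonneg A).trans hA
  rw [rfac, norm_prod]
  calc ∏ i ∈ range k, ‖1 - A * p ^ i‖ ≤ ∏ i ∈ range k, (1 + R * ‖p‖ ^ i) := by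
        refine prod_le_prod (fun _ _ => norm_nonneg _) fun i _ => ?_
        refine (norm_sub_le _ _).trans ?_
        rw [norm_one, norm_mul, norm_pow]
        gcongr
    _ ≤ Real.exp (∑ i ∈ range k, R * ‖p‖ ^ i) :=
        Real.prod_one_add_le_exp_sum _ fun i => by positivity
    _ ≤ _ := by
        rw [Real.exp_le_exp, ← mul_sum, ← tsum_geometric_of_lt_one (norm_nonneg p) hp1]
        gcongr
        exact (summable_geometric_of_lt_one (norm_nonneg p) hp1).sum_le_tsum _
          fun i _ => by positivity

theorem exists_norm_inv_rfac_le (hp1 : ‖p‖ < 1) {A : ℂ} (hA : ∀ i : ℕ, 1 - A * p ^ i ≠ 0) :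
    ∃ K, ∀ k, ‖(rfac A p k)⁻¹‖ ≤ K := by
  obtain ⟨K, hK⟩ := (Metric.isBounded_range_of_tendsto _
    ((tendsto_rfac hp1 A).inv₀ (rfacInf_ne_zero hp1 hA))).exists_norm_le
  exact ⟨K, fun k => hK _ ⟨k, rfl⟩⟩

end Products

section Bounds

variable {n : ℕ} {p : ℂ} {x : Fin n → ℂ}

theorem norm_diffProd_shift_le (hp1 : ‖p‖ < 1) (x : Fin n → ℂ) (k : Fin n → ℕ) :
    ‖diffProd (shift p x k)‖ ≤ ∏ r : Fin n, ∏ s ∈ Ioi r, (‖x r‖ + ‖x s‖) := by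
  have h (r : Fin n) : ‖shift p x k r‖ ≤ ‖x r‖ := by
    rw [shift, norm_mul, norm_pow]
    exact mul_le_of_le_one_right (norm_nonneg _) (pow_le_one₀ (norm_nonneg p) hp1.le)
  simp only [diffProd, norm_prod]
  exact prod_le_prod (fun _ _ => prod_nonneg fun _ _ => norm_nonneg _) fun r _ =>
    prod_le_prod (fun _ _ => norm_nonneg _) fun s _ =>
      (norm_sub_le _ _).trans (add_le_add (h r) (h s))

/-- The terms of the `q`-binomial series are bounded, uniformly in bounded parameters. -/
theorem exists_norm_binTerm_le (hp1 : ‖p‖ < 1) (hx0 : ∀ r, x r ≠ 0)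
    (hx : ∀ r s, r ≠ s → ∀ i : ℕ, x r * p ^ i ≠ x s) (a₀ : Fin n → ℂ) :
    ∃ K : ℝ, ∀ a : Fin n → ℂ, (∀ s, ‖a s‖ ≤ ‖a₀ s‖) → ∀ k, ‖binTerm p a x k‖ ≤ K := by
  have h1 (r s : Fin n) := exists_norm_inv_rfac_le hp1 (one_sub_base_mul_ne_zero hp1 hx0 hx r s)
  choose C hC using h1
  refine ⟨(∏ r : Fin n, ∏ s ∈ Ioi r, (‖x r‖ + ‖x s‖)) * ‖(diffProd x)⁻¹‖ *
    ((∏ r, ∏ s, Real.exp (‖a₀ s * x r / x s‖ * (1 - ‖p‖)⁻¹)) * ∏ r, ∏ s, C r s),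
    fun a ha k => ?_⟩
  rw [binTerm, div_eq_mul_inv, div_eq_mul_inv, norm_mul, norm_mul, norm_mul]
  have hA : ‖gridFac p a x k‖ ≤ ∏ r, ∏ s, Real.exp (‖a₀ s * x r / x s‖ * (1 - ‖p‖)⁻¹) := by
    simp only [gridFac, norm_prod]
    refine prod_le_prod (fun _ _ => prod_nonneg fun _ _ => norm_nonneg _) fun r _ =>
      prod_le_prod (fun _ _ => norm_nonneg _) fun s _ => norm_rfac_le hp1 ?_ _
    rw [norm_div, norm_div, norm_mul, norm_mul]
    gcongr
    exact ha s
  have hB : ‖(gridFac p (fun _ => p) x k)⁻¹‖ ≤ ∏ r, ∏ s, C r s := by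
    simp only [gridFac, ← prod_inv_distrib, norm_prod]
    exact prod_le_prod (fun _ _ => prod_nonneg fun _ _ => norm_nonneg _) fun r _ =>
      prod_le_prod (fun _ _ => norm_nonneg _) fun s _ => hC r s _
  have hD := norm_diffProd_shift_le hp1 x k
  gcongr

theorem summable_prod_pow {ρ : Fin n → ℝ} (h0 : ∀ r, 0 ≤ ρ r) (h1 : ∀ r, ρ r < 1) :
    Summable fun k : Fin n → ℕ => ∏ r, ρ r ^ k r := by
  refine summable_of_sum_le (c := ∏ r, (1 - ρ r)⁻¹)
    (fun k => prod_nonneg fun r _ => pow_nonneg (h0 r) _) fun S => ?_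
  calc ∑ k ∈ S, ∏ r, ρ r ^ k r
      ≤ ∑ k ∈ Fintype.piFinset fun r => S.image (· r), ∏ r, ρ r ^ k r := by
        refine sum_le_sum_of_subset_of_nonneg (fun k hk => ?_)
          fun k _ _ => prod_nonneg fun r _ => pow_nonneg (h0 r) _
        exact Fintype.mem_piFinset.2 fun r => mem_image_of_mem _ hk
    _ = ∏ r, ∑ i ∈ S.image (· r), ρ r ^ i := (prod_univ_sum _ _).symm
    _ ≤ _ := by
        refine prod_le_prod (fun r _ => sum_nonneg fun i _ => pow_nonneg (h0 r) _) fun r _ => ?_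
        rw [← tsum_geometric_of_lt_one (h0 r) (h1 r)]
        exact (summable_geometric_of_lt_one (h0 r) (h1 r)).sum_le_tsum _
          fun i _ => pow_nonneg (h0 r) _

theorem summable_pow_size {ρ : ℝ} (h0 : 0 ≤ ρ) (h1 : ρ < 1) :
    Summable fun k : Fin n → ℕ => ρ ^ size k := by
  simp only [size, ← prod_pow_eq_pow_sum]
  exact summable_prod_pow (fun _ => h0) fun _ => h1

theorem norm_dualTerm_mul_pow_le (hp1 : ‖p‖ < 1) (b x : Fin n → ℂ) (w : ℂ) (k : Fin n → ℕ) :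
    ‖dualTerm p b x k * w ^ size k‖ ≤ ‖binTerm p b x k‖ * ∏ r, ‖w / x r‖ ^ k r := by
  have e : dualTerm p b x k * w ^ size k =
      binTerm p b x k * p ^ e2 k * ∏ r, (w / x r) ^ k r := by
    simp only [dualTerm, size, ← prod_pow_eq_pow_sum, div_eq_mul_inv, mul_pow, inv_pow, prod_mul_distrib]
    ring
  rw [e, norm_mul, norm_mul, norm_prod, norm_pow]
  simp only [norm_pow]
  refine mul_le_mul_of_nonneg_right (mul_le_of_le_one_right (norm_nonneg _)
    (pow_le_one₀ (norm_nonneg p) hp1.le)) (prod_nonneg fun r _ => by positivity)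

/-- The sum of a multiple series by total degree. -/
theorem hasSum_piAntidiag {f : (Fin n → ℕ) → ℂ} (hf : Summable f) :
    HasSum (fun N => ∑ k ∈ piAntidiag univ N, f k) (∑' k, f k) := by
  have h := hf.hasSum.tsum_fiberwise size
  refine h.congr_fun fun N => ?_
  have e : (size ⁻¹' {N} : Set (Fin n → ℕ)) = ((piAntidiag univ N : Finset (Fin n → ℕ)) : Set _) := by
    ext k
    rw [mem_coe, mem_piAntidiag_univ]
    rfl
  rw [e]
  exact (Finset.tsum_subtype' _ f).symm

theorem hasSum_piAntidiag_mul_pow {f : (Fin n → ℕ) → ℂ} {z : ℂ}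
    (hf : Summable fun k => f k * z ^ size k) :
    HasSum (fun N => (∑ k ∈ piAntidiag univ N, f k) * z ^ N) (∑' k, f k * z ^ size k) := by
  convert hasSum_piAntidiag hf using 2 with N
  rw [sum_mul]
  exact sum_congr rfl fun k hk => by rw [mem_piAntidiag_univ.1 hk]

theorem size_eq_zero {k : Fin n → ℕ} : size k = 0 ↔ k = 0 := by
  simp [size, funext_iff]

theorem sum_piAntidiag_zero (f : (Fin n → ℕ) → ℂ) : ∑ k ∈ piAntidiag univ 0, f k = f 0 := by
  rw [← sum_singleton f 0]
  refine sum_congr (Finset.ext fun k => ?_) fun _ _ => rfl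
  rw [mem_piAntidiag_univ, size_eq_zero, mem_singleton]

theorem binTerm_zero (hx : Function.Injective x) (a : Fin n → ℂ) : binTerm p a x 0 = 1 := by
  have e : shift p x 0 = x := funext fun r => by simp [shift]
  rw [binTerm, e, div_self (diffProd_ne_zero hx)]
  simp [gridFac]

theorem dualTerm_zero (hx : Function.Injective x) (a : Fin n → ℂ) : dualTerm p a x 0 = 1 := by
  rw [dualTerm, binTerm_zero hx]
  simp [e2]

end Bounds

section Series

variable {n : ℕ} {p : ℂ} {x : Fin n → ℂ}

/-- The `A_n` `q`-binomial series. -/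
noncomputable def binSeries (p : ℂ) {n : ℕ} (a x : Fin n → ℂ) (z : ℂ) : ℂ :=
  ∑' k, binTerm p a x k * z ^ size k

/-- The second `A_n` `q`-binomial series. -/
noncomputable def dualSeries (p : ℂ) {n : ℕ} (b x : Fin n → ℂ) (w : ℂ) : ℂ :=
  ∑' k, dualTerm p b x k * w ^ size k

theorem summable_norm_binTerm (hp1 : ‖p‖ < 1) (hx0 : ∀ r, x r ≠ 0)
    (hx : ∀ r s, r ≠ s → ∀ i : ℕ, x r * p ^ i ≠ x s) (a : Fin n → ℂ) {z : ℂ} (hz : ‖z‖ < 1) :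
    Summable fun k => ‖binTerm p a x k * z ^ size k‖ := by
  obtain ⟨K, hK⟩ := exists_norm_binTerm_le hp1 hx0 hx a
  refine ((summable_pow_size (norm_nonneg z) hz).mul_left K).of_nonneg_of_le
    (fun _ => norm_nonneg _) fun k => ?_
  rw [norm_mul, norm_pow]
  exact mul_le_mul_of_nonneg_right (hK a (fun _ => le_rfl) k) (by positivity)

theorem summable_norm_dualTerm (hp1 : ‖p‖ < 1) (hx0 : ∀ r, x r ≠ 0)
    (hx : ∀ r s, r ≠ s → ∀ i : ℕ, x r * p ^ i ≠ x s) (b : Fin n → ℂ) {w : ℂ}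
    (hw : ∀ r, ‖w / x r‖ < 1) : Summable fun k => ‖dualTerm p b x k * w ^ size k‖ := by
  obtain ⟨K, hK⟩ := exists_norm_binTerm_le hp1 hx0 hx b
  refine ((summable_prod_pow (fun r => norm_nonneg (w / x r)) hw).mul_left K).of_nonneg_of_le
    (fun _ => norm_nonneg _) fun k => (norm_dualTerm_mul_pow_le hp1 b x w k).trans ?_
  exact mul_le_mul_of_nonneg_right (hK b (fun _ => le_rfl) k)
    (prod_nonneg fun r _ => by positivity)

theorem norm_mul_pow_lt_one (hp1 : ‖p‖ < 1) {z : ℂ} (hz : ‖z‖ < 1) (N : ℕ) :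
    ‖z * p ^ N‖ < 1 := by
  rw [norm_mul, norm_pow]
  exact mul_lt_one_of_nonneg_of_lt_one_left (norm_nonneg z) hz
    (pow_le_one₀ (norm_nonneg p) hp1.le)

theorem binSeries_functional (hp : p ≠ 0) (hp1 : ‖p‖ < 1) (hx0 : ∀ r, x r ≠ 0)
    (hx : ∀ r s, r ≠ s → ∀ i : ℕ, x r * p ^ i ≠ x s) (a : Fin n → ℂ) {z : ℂ} (hz : ‖z‖ < 1) :
    (1 - z) * binSeries p a x z = (1 - (∏ s, a s) * z) * binSeries p a x (z * p) := by
  have hz' : ‖z * p‖ < 1 := by simpa using norm_mul_pow_lt_one hp1 hz 1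
  have h1 := hasSum_piAntidiag_mul_pow (summable_norm_binTerm hp1 hx0 hx a hz).of_norm
  have h2 := hasSum_piAntidiag_mul_pow (summable_norm_binTerm hp1 hx0 hx a hz').of_norm
  have h3 := (hasSum_nat_add_iff' 1).2 (h1.sub h2)
  have h4 := (h1.sub (h2.mul_left (∏ s, a s))).mul_left z
  rw [range_one, sum_singleton, pow_zero, pow_zero, sub_self, sub_zero] at h3
  have h5 := h3.unique (h4.congr_fun ?_)
  · rw [binSeries, binSeries]
    linear_combination h5
  · intro N
    linear_combination z ^ (N + 1) * sum_binTerm_succ hp hp1 hx0 hx a N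

theorem binSeries_mul_rfac (hp : p ≠ 0) (hp1 : ‖p‖ < 1) (hx0 : ∀ r, x r ≠ 0)
    (hx : ∀ r s, r ≠ s → ∀ i : ℕ, x r * p ^ i ≠ x s) (a : Fin n → ℂ) {z : ℂ} (hz : ‖z‖ < 1)
    (M : ℕ) : binSeries p a x z * rfac z p M =
      rfac ((∏ s, a s) * z) p M * binSeries p a x (z * p ^ M) := by
  induction M with
  | zero => simp
  | succ M ih =>
    have h := binSeries_functional hp hp1 hx0 hx a (norm_mul_pow_lt_one hp1 hz M)
    rw [rfac_succ, rfac_succ, ← mul_assoc, ih, pow_succ, ← mul_assoc]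
    linear_combination rfac ((∏ s, a s) * z) p M * h

theorem binSeries_zero (hx : Function.Injective x) (a : Fin n → ℂ) : binSeries p a x 0 = 1 := by
  rw [binSeries, tsum_eq_single 0, binTerm_zero hx]
  · simp [size]
  · intro k hk
    rw [zero_pow (mt size_eq_zero.1 hk), mul_zero]

/-- Milne's `A_n` `q`-binomial theorem. -/
theorem binSeries_mul_rfacInf (hp : p ≠ 0) (hp1 : ‖p‖ < 1) (hx0 : ∀ r, x r ≠ 0)
    (hx : ∀ r s, r ≠ s → ∀ i : ℕ, x r * p ^ i ≠ x s) (a : Fin n → ℂ) {z : ℂ} (hz : ‖z‖ < 1) :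
    binSeries p a x z * rfacInf z p = rfacInf ((∏ s, a s) * z) p := by
  have hlim : Tendsto (fun M => binSeries p a x (z * p ^ M)) atTop (𝓝 1) := by
    rw [← binSeries_zero (p := p) (injective_of_mul_pow_ne hx) a]
    refine tendsto_tsum_of_dominated_convergence (summable_norm_binTerm hp1 hx0 hx a hz)
      (fun k => ?_) (Eventually.of_forall fun M k => ?_)
    · have h : Tendsto (fun M => z * p ^ M) atTop (𝓝 0) := by
        simpa using (tendsto_pow_atTop_nhds_zero_of_norm_lt_one hp1).const_mul z
      exact (h.pow _).const_mul _
    · rw [norm_mul, norm_mul, norm_pow, norm_pow, norm_mul, norm_pow]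
      gcongr
      exact mul_le_of_le_one_right (norm_nonneg _) (pow_le_one₀ (norm_nonneg p) hp1.le)
  have h1 := (tendsto_rfac hp1 z).const_mul (binSeries p a x z)
  have h2 := (tendsto_rfac hp1 ((∏ s, a s) * z)).mul hlim
  rw [mul_one] at h2
  exact tendsto_nhds_unique (h1.congr fun M => binSeries_mul_rfac hp hp1 hx0 hx a hz M) h2

theorem dualSeries_update (hp : p ≠ 0) (hp1 : ‖p‖ < 1) (hx0 : ∀ r, x r ≠ 0)
    (hx : ∀ r s, r ≠ s → ∀ i : ℕ, x r * p ^ i ≠ x s) (b : Fin n → ℂ) {w : ℂ}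
    (hw : ∀ r, ‖w / x r‖ < 1) (s : Fin n) :
    dualSeries p b x w =
      (1 - b s * w / x s) * dualSeries p (Function.update b s (b s * p)) x w := by
  have hinj := injective_of_mul_pow_ne hx
  have h1 := hasSum_piAntidiag_mul_pow (summable_norm_dualTerm hp1 hx0 hx b hw).of_norm
  have h2 := hasSum_piAntidiag_mul_pow
    (summable_norm_dualTerm hp1 hx0 hx (Function.update b s (b s * p)) hw).of_norm
  have h3 := (hasSum_nat_add_iff' 1).2 (h1.sub h2)
  have h4 := h2.mul_left (-(b s * w / x s))
  rw [range_one, sum_singleton, sum_piAntidiag_zero, sum_piAntidiag_zero, dualTerm_zero hinj,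
    dualTerm_zero hinj, sub_self, sub_zero] at h3
  have h5 := h3.unique (h4.congr_fun ?_)
  · rw [dualSeries, dualSeries]
    linear_combination h5
  · intro N
    linear_combination w ^ (N + 1) * sum_dualTerm_succ hp hp1 hx0 hx b s N

theorem dualSeries_piecewise (hp : p ≠ 0) (hp1 : ‖p‖ < 1) (hx0 : ∀ r, x r ≠ 0)
    (hx : ∀ r s, r ≠ s → ∀ i : ℕ, x r * p ^ i ≠ x s) (b : Fin n → ℂ) {w : ℂ}
    (hw : ∀ r, ‖w / x r‖ < 1) (S : Finset (Fin n)) :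
    dualSeries p b x w = (∏ s ∈ S, (1 - b s * w / x s)) *
      dualSeries p (S.piecewise (fun s => b s * p) b) x w := by
  induction S using Finset.induction_on with
  | empty => simp
  | insert s S hs ih =>
    rw [ih, prod_insert hs, piecewise_insert, dualSeries_update hp hp1 hx0 hx _ hw s,
      piecewise_eq_of_notMem _ _ _ hs]
    ring

theorem dualSeries_eq_prod_rfac (hp : p ≠ 0) (hp1 : ‖p‖ < 1) (hx0 : ∀ r, x r ≠ 0)
    (hx : ∀ r s, r ≠ s → ∀ i : ℕ, x r * p ^ i ≠ x s) (b : Fin n → ℂ) {w : ℂ}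
    (hw : ∀ r, ‖w / x r‖ < 1) (M : ℕ) :
    dualSeries p b x w = (∏ s, rfac (b s * w / x s) p M) *
      dualSeries p (fun s => b s * p ^ M) x w := by
  induction M with
  | zero => simp
  | succ M ih =>
    have h := dualSeries_piecewise hp hp1 hx0 hx (fun s => b s * p ^ M) hw univ
    rw [piecewise_univ] at h
    simp only [rfac_succ, prod_mul_distrib, pow_succ, ← mul_assoc]
    rw [ih, h, mul_assoc]
    congr 2
    exact prod_congr rfl fun s _ => by ring

theorem dualSeries_eq_prod_rfacInf (hp : p ≠ 0) (hp1 : ‖p‖ < 1) (hx0 : ∀ r, x r ≠ 0)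
    (hx : ∀ r s, r ≠ s → ∀ i : ℕ, x r * p ^ i ≠ x s) (b : Fin n → ℂ) {w : ℂ}
    (hw : ∀ r, ‖w / x r‖ < 1) :
    dualSeries p b x w = (∏ s, rfacInf (b s * w / x s) p) * dualSeries p (fun _ => 0) x w := by
  have hlim : Tendsto (fun M => dualSeries p (fun s => b s * p ^ M) x w) atTop
      (𝓝 (dualSeries p (fun _ => 0) x w)) := by
    obtain ⟨K, hK⟩ := exists_norm_binTerm_le hp1 hx0 hx b
    refine tendsto_tsum_of_dominated_convergence
      ((summable_prod_pow (fun r => norm_nonneg (w / x r)) hw).mul_left K)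
      (fun k => ?_) (Eventually.of_forall fun M k => ?_)
    · have h : Tendsto (fun M => fun s => b s * p ^ M) atTop (𝓝 fun _ => 0) := by
        refine tendsto_pi_nhds.2 fun s => ?_
        simpa using (tendsto_pow_atTop_nhds_zero_of_norm_lt_one hp1).const_mul (b s)
      exact (((continuous_dualTerm x k).tendsto _).comp h).mul_const _
    · refine (norm_dualTerm_mul_pow_le hp1 _ x w k).trans ?_
      refine mul_le_mul_of_nonneg_right (hK _ (fun s => ?_) k)
        (prod_nonneg fun r _ => by positivity)
      rw [norm_mul, norm_pow]
      exact mul_le_of_le_one_right (norm_nonneg _) (pow_le_one₀ (norm_nonneg p) hp1.le)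
  refine tendsto_nhds_unique (tendsto_const_nhds.congr fun M =>
    dualSeries_eq_prod_rfac hp hp1 hx0 hx b hw M) (Tendsto.mul ?_ hlim)
  exact tendsto_finsetProd _ fun s _ => tendsto_rfac hp1 _

theorem dualSeries_one (hx0 : ∀ r, x r ≠ 0)
    (hx : ∀ r s, r ≠ s → ∀ i : ℕ, x r * p ^ i ≠ x s) (w : ℂ) :
    dualSeries p (fun _ => 1) x w = 1 := by
  rw [dualSeries, tsum_eq_single 0, dualTerm_zero (injective_of_mul_pow_ne hx)]
  · simp [size]
  · intro k hk
    obtain ⟨r, hr⟩ := Function.ne_iff.1 hk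
    obtain ⟨i, hi⟩ := Nat.exists_eq_succ_of_ne_zero hr
    have h : gridFac p (fun _ => 1) x k = 0 := by
      refine prod_eq_zero (mem_univ r) (prod_eq_zero (mem_univ r) ?_)
      rw [one_mul, div_self (hx0 r), hi, Nat.succ_eq_add_one, rfac_succ', sub_self, zero_mul]
    rw [dualTerm, binTerm, h]
    ring

/-- The second `A_n` `q`-binomial theorem. -/
theorem dualSeries_mul_prod_rfacInf (hp : p ≠ 0) (hp1 : ‖p‖ < 1) (hx0 : ∀ r, x r ≠ 0)
    (hx : ∀ r s, r ≠ s → ∀ i : ℕ, x r * p ^ i ≠ x s) (b : Fin n → ℂ) {w : ℂ}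
    (hw : ∀ r, ‖w / x r‖ < 1) :
    dualSeries p b x w * ∏ s, rfacInf (w / x s) p = ∏ s, rfacInf (b s * w / x s) p := by
  have h1 := dualSeries_eq_prod_rfacInf hp hp1 hx0 hx (fun _ => 1) hw
  rw [dualSeries_one hx0 hx] at h1
  simp only [one_mul] at h1
  rw [dualSeries_eq_prod_rfacInf hp hp1 hx0 hx b hw]
  linear_combination (-∏ s, rfacInf (b s * w / x s) p) * h1

end Series

theorem qPow_add (L s u : ℂ) : qPow L (s + u) = qPow L s * qPow L u := by
  rw [qPow, add_mul, Complex.exp_add]; rfl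

theorem qPow_mul_nat (L s : ℂ) (k : ℕ) : qPow L (s * k) = qPow L s ^ k := by
  rw [qPow, qPow, ← Complex.exp_nat_mul]
  congr 1
  ring

theorem qPow_ne_zero (L s : ℂ) : qPow L s ≠ 0 := Complex.exp_ne_zero _

theorem qPow_mul_sum (L h : ℂ) {n : ℕ} (k : Fin n → ℕ) :
    qPow L (h * ∑ r : Fin n, ((r : ℕ) : ℂ) * (k r : ℂ)) = ∏ r, (qPow L h ^ k r) ^ (r : ℕ) := by
  rw [mul_sum, qPow, sum_mul, Complex.exp_sum]
  refine prod_congr rfl fun r _ => ?_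
  rw [← pow_mul, ← qPow_mul_nat, qPow]
  push_cast
  congr 1
  ring

theorem prod_pow_val_eq_prod_Ioi {n : ℕ} (f : Fin n → ℂ) :
    ∏ r : Fin n, f r ^ (r : ℕ) = ∏ r, ∏ s ∈ Ioi r, f s := by
  have h : ∀ r ∈ (univ : Finset (Fin n)), f r ^ (r : ℕ) = ∏ s ∈ Iio r, f r := fun r _ => by
    rw [prod_const, Fin.card_Iio]
  rw [prod_congr rfl h]
  exact prod_comm' fun r s => by simp

theorem vandermonde_mul_qPow (L h : ℂ) {n : ℕ} {x : Fin n → ℂ} (hx0 : ∀ r, x r ≠ 0)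
    (k : Fin n → ℕ) :
    vandermonde L h x k * qPow L (h * ∑ r : Fin n, ((r : ℕ) : ℂ) * (k r : ℂ)) =
      diffProd (shift (qPow L h) x k) / diffProd x := by
  rw [qPow_mul_sum, prod_pow_val_eq_prod_Ioi, vandermonde, diffProd, diffProd, ← prod_mul_distrib,
    ← prod_div_distrib]
  refine prod_congr rfl fun r _ => ?_
  rw [← prod_mul_distrib, ← prod_div_distrib]
  refine prod_congr rfl fun s _ => ?_
  have h1 : qPow L (h * ((k r : ℂ) - k s)) * qPow L h ^ k s = qPow L h ^ k r := by
    rw [← qPow_mul_nat, ← qPow_mul_nat, ← qPow_add]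
    congr 1
    ring
  have h2 : (1 - qPow L (h * ((k r : ℂ) - k s)) * (x r / x s)) * qPow L h ^ k s =
      -(shift (qPow L h) x k r - shift (qPow L h) x k s) / x s := by
    rw [sub_mul, mul_right_comm, h1, shift, shift]
    have := hx0 s
    field_simp
    ring
  have h3 : 1 - x r / x s = -(x r - x s) / x s := by
    have := hx0 s
    field_simp
    ring
  rw [div_mul_eq_mul_div, h2, h3, div_div_div_cancel_right₀ (hx0 s), neg_div_neg_eq]

theorem sqProd_eq (L h : ℂ) {n : ℕ} (a x : Fin n → ℂ) (k : Fin n → ℕ) :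
    sqProd L h a x k = gridFac (qPow L h) a x k / gridFac (qPow L h) (fun _ => qPow L h) x k := by
  simp only [sqProd, gridFac, prod_div_distrib, mul_div_assoc]

theorem vandermonde_mul_sqProd_mul_qPow (L h : ℂ) {n : ℕ} (a : Fin n → ℂ) {x : Fin n → ℂ}
    (hx0 : ∀ r, x r ≠ 0) (k : Fin n → ℕ) :
    vandermonde L h x k * sqProd L h a x k *
      qPow L (h * ∑ r : Fin n, ((r : ℕ) : ℂ) * (k r : ℂ)) = binTerm (qPow L h) a x k := by
  rw [binTerm, ← vandermonde_mul_qPow L h hx0, ← sqProd_eq]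
  ring

theorem rfacC_div_rfacC (L c A B : ℂ) (d : ℂ) (N : ℕ) :
    rfacC L c A (d * N) / rfacC L c B (d * N) =
      rfacInf A (qPow L c) / rfacInf B (qPow L c) *
        (rfacInf (B * qPow L (c * d) ^ N) (qPow L c) /
          rfacInf (A * qPow L (c * d) ^ N) (qPow L c)) := by
  rw [rfacC, rfacC, div_div_div_eq, div_mul_div_comm, ← mul_assoc, qPow_mul_nat]
  congr 1
  ring

section Main

variable {n m : ℕ} {L h t : ℂ} {a x : Fin n → ℂ} {b y : Fin m → ℂ} {z w : ℂ}

theorem norm_mul_pow_div_lt_one {Q : ℂ} (hQ : ‖Q‖ < 1) (hw : ∀ r, ‖w / y r‖ < 1) (N : ℕ)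
    (r : Fin m) : ‖w * Q ^ N / y r‖ < 1 := by
  rw [mul_div_right_comm]
  exact norm_mul_pow_lt_one hQ (hw r) N

theorem leftTerm_eq (hqt : ‖qPow L t‖ < 1) (hqht : ‖qPow L (h * t)‖ < 1)
    (hx0 : ∀ r, x r ≠ 0) (hy0 : ∀ r, y r ≠ 0) (hw : ∀ r, ‖w / y r‖ < 1)
    (hy : ∀ r s, r ≠ s → ∀ i : ℕ, y r * qPow L t ^ i ≠ y s) (k : Fin n → ℕ) :
    leftTerm L h t a x b y z w k =
      (∏ r, rfacInf (w / y r) (qPow L t) / rfacInf (b r * w / y r) (qPow L t)) *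
        (binTerm (qPow L h) a x k * z ^ size k *
          dualSeries (qPow L t) b y (w * qPow L (h * t) ^ size k)) := by
  have hwk := norm_mul_pow_div_lt_one hqht hw (size k)
  have hD := dualSeries_mul_prod_rfacInf (qPow_ne_zero L t) hqt hy0 hy b hwk
  have hne : ∏ s, rfacInf (w * qPow L (h * t) ^ size k / y s) (qPow L t) ≠ 0 :=
    prod_ne_zero_iff.2 fun s _ => rfacInf_ne_zero_of_norm_lt_one hqt (hwk s)
  rw [eq_div_of_mul_eq hne hD, ← prod_div_distrib, ← vandermonde_mul_sqProd_mul_qPow L h a hx0,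
    leftTerm]
  simp only [rfacC_div_rfacC, prod_mul_distrib]
  have e : ∏ r, rfacInf (b r * w / y r * qPow L (t * h) ^ size k) (qPow L t) /
      rfacInf (w / y r * qPow L (t * h) ^ size k) (qPow L t) =
      ∏ r, rfacInf (b r * (w * qPow L (h * t) ^ size k) / y r) (qPow L t) /
      rfacInf (w * qPow L (h * t) ^ size k / y r) (qPow L t) := by
    refine prod_congr rfl fun r _ => ?_
    rw [mul_comm t h]
    congr 2 <;> ring
  rw [e]
  ring

theorem rightTerm_eq (hqh : ‖qPow L h‖ < 1) (hqht : ‖qPow L (h * t)‖ < 1)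
    (hx0 : ∀ r, x r ≠ 0) (hy0 : ∀ r, y r ≠ 0) (hz : ‖z‖ < 1)
    (hx : ∀ r s, r ≠ s → ∀ i : ℕ, x r * qPow L h ^ i ≠ x s)
    (ha : ∀ i : ℕ, (∏ r, a r) * z * qPow L h ^ i ≠ 1) (j : Fin m → ℕ) :
    rfacInf ((∏ r, a r) * z) (qPow L h) / rfacInf z (qPow L h) * rightTerm L h t a b y z w j =
      dualTerm (qPow L t) b y j * w ^ size j *
        binSeries (qPow L h) a x (z * qPow L (h * t) ^ size j) := by
  have hzj := norm_mul_pow_lt_one hqht hz (size j)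
  have hB := binSeries_mul_rfacInf (qPow_ne_zero L h) hqh hx0 hx a hzj
  have h1 := rfacInf_ne_zero_of_norm_lt_one hqh hzj
  have h2 := rfacInf_ne_zero_of_norm_lt_one hqh hz
  have h3 : rfacInf ((∏ r, a r) * z) (qPow L h) ≠ 0 :=
    rfacInf_ne_zero hqh fun i => sub_ne_zero.2 (ha i).symm
  rw [eq_div_of_mul_eq h1 hB, dualTerm, ← vandermonde_mul_sqProd_mul_qPow L t b hy0, rightTerm,
    rfacC_div_rfacC, qPow_mul_nat, ← mul_assoc (∏ r, a r) z]
  field_simp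

theorem summable_bibasic (hqh : ‖qPow L h‖ < 1) (hqt : ‖qPow L t‖ < 1)
    (hqht : ‖qPow L (h * t)‖ < 1) (hx0 : ∀ r, x r ≠ 0) (hy0 : ∀ r, y r ≠ 0)
    (hz : ‖z‖ < 1) (hw : ∀ r, ‖w / y r‖ < 1)
    (hx : ∀ r s, r ≠ s → ∀ i : ℕ, x r * qPow L h ^ i ≠ x s)
    (hy : ∀ r s, r ≠ s → ∀ i : ℕ, y r * qPow L t ^ i ≠ y s) :
    Summable fun kj : (Fin n → ℕ) × (Fin m → ℕ) => ‖(binTerm (qPow L h) a x kj.1 * z ^ size kj.1) *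
      (dualTerm (qPow L t) b y kj.2 * w ^ size kj.2) *
        qPow L (h * t) ^ (size kj.1 * size kj.2)‖ := by
  refine ((summable_norm_binTerm hqh hx0 hx a hz).mul_norm
    (summable_norm_dualTerm hqt hy0 hy b hw)).of_nonneg_of_le (fun _ => norm_nonneg _) fun kj => ?_
  rw [norm_mul _ (qPow L (h * t) ^ _), norm_pow]
  exact mul_le_of_le_one_right (norm_nonneg _) (pow_le_one₀ (norm_nonneg _) hqht.le)

theorem summable_norm_tsum_of_prod {α β : Type*} {f : α × β → ℂ} (hf : Summable fun p => ‖f p‖) :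
    Summable fun i => ‖∑' j, f (i, j)‖ :=
  hf.prod.of_nonneg_of_le (fun _ => norm_nonneg _) fun i =>
    norm_tsum_le_tsum_norm (hf.prod_factor i)

end Main

end BibasicHeine

theorem mainTheorem5 (n m : ℕ) (hn : 0 < n) (hm : 0 < m)
    (q L h t : ℂ) (hL : Complex.exp L = q)
    (hqh : ‖BibasicHeine.qPow L h‖ < 1) (hqt : ‖BibasicHeine.qPow L t‖ < 1)
    (hqht : ‖BibasicHeine.qPow L (h * t)‖ < 1)
    (a x : Fin n → ℂ) (b y : Fin m → ℂ) (z w : ℂ)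
    (hx0 : ∀ r, x r ≠ 0) (hy0 : ∀ r, y r ≠ 0)
    (hz : ‖z‖ < 1) (hw : ∀ r, ‖w / y r‖ < 1)
    -- no denominator on either side vanishes
    (hx : ∀ r s, r ≠ s → ∀ i : ℕ, x r * BibasicHeine.qPow L h ^ i ≠ x s)
    (hy : ∀ r s, r ≠ s → ∀ i : ℕ, y r * BibasicHeine.qPow L t ^ i ≠ y s)
    (ha : ∀ i : ℕ, (∏ r, a r) * z * BibasicHeine.qPow L h ^ i ≠ 1)
    (hb : ∀ r, ∀ i : ℕ, b r * w / y r * BibasicHeine.qPow L t ^ i ≠ 1) :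
    Summable (fun k : Fin n → ℕ => ‖BibasicHeine.leftTerm L h t a x b y z w k‖) ∧
    Summable (fun j : Fin m → ℕ => ‖BibasicHeine.rightTerm L h t a b y z w j‖) ∧
    ∑' k : Fin n → ℕ, BibasicHeine.leftTerm L h t a x b y z w k =
      (∏ r, BibasicHeine.rfacInf (w / y r) (BibasicHeine.qPow L t) /
          BibasicHeine.rfacInf (b r * w / y r) (BibasicHeine.qPow L t)) *
        (BibasicHeine.rfacInf ((∏ r, a r) * z) (BibasicHeine.qPow L h) /
          BibasicHeine.rfacInf z (BibasicHeine.qPow L h)) *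
        ∑' j : Fin m → ℕ, BibasicHeine.rightTerm L h t a b y z w j := by
  open BibasicHeine in
  obtain ⟨f, hfdef⟩ : ∃ f : (Fin n → ℕ) × (Fin m → ℕ) → ℂ, f = fun kj =>
    (binTerm (qPow L h) a x kj.1 * z ^ size kj.1) *
      (dualTerm (qPow L t) b y kj.2 * w ^ size kj.2) * qPow L (h * t) ^ (size kj.1 * size kj.2) :=
    ⟨_, rfl⟩
  have hf : Summable fun kj => ‖f kj‖ :=
    hfdef ▸ summable_bibasic hqh hqt hqht hx0 hy0 hz hw hx hy
  have hfs : Summable fun jk : (Fin m → ℕ) × (Fin n → ℕ) => ‖f jk.swap‖ := hf.prod_symm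
  have hD : rfacInf ((∏ r, a r) * z) (qPow L h) / rfacInf z (qPow L h) ≠ 0 :=
    div_ne_zero (rfacInf_ne_zero hqh fun i => sub_ne_zero.2 (ha i).symm)
      (rfacInf_ne_zero_of_norm_lt_one hqh hz)
  have hl : ∀ k, leftTerm L h t a x b y z w k =
      (∏ r, rfacInf (w / y r) (qPow L t) / rfacInf (b r * w / y r) (qPow L t)) *
        ∑' j, f (k, j) := fun k => by
    rw [leftTerm_eq hqt hqht hx0 hy0 hw hy, dualSeries, ← tsum_mul_left]
    congr 1
    refine tsum_congr fun j => ?_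
    rw [hfdef, mul_pow, ← pow_mul]
    ring
  have hr : ∀ j, rfacInf ((∏ r, a r) * z) (qPow L h) / rfacInf z (qPow L h) *
      rightTerm L h t a b y z w j = ∑' k, f (k, j) := fun j => by
    rw [rightTerm_eq hqh hqht hx0 hy0 hz hx ha, binSeries, ← tsum_mul_left]
    refine tsum_congr fun k => ?_
    rw [hfdef, mul_pow, ← pow_mul, mul_comm (size j)]
    ring
  refine ⟨?_, ?_, ?_⟩
  · simp only [hl, norm_mul]
    exact (summable_norm_tsum_of_prod hf).mul_left _
  · have hs : Summable fun j => ‖∑' k, f (k, j)‖ :=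
      summable_norm_tsum_of_prod (f := fun jk => f jk.swap) hfs
    refine (summable_mul_left_iff (norm_ne_zero_iff.2 hD)).1 (hs.congr fun j => ?_)
    rw [← hr, norm_mul]
  · rw [tsum_congr hl, tsum_mul_left, mul_assoc, ← tsum_mul_left (f := rightTerm L h t a b y z w),
      tsum_congr hr, Summable.tsum_comm (f := fun k j => f (k, j)) hf.of_norm]
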